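/- Let $\mathbb{F}_q$ be a finite field with $q \equiv 1 \pmod 3$. Call two elliptic curves over $\mathbb{F}_q$, given by Weierstrass equations, isomorphic if they are isomorphic over $\mathbb{F}_q$, i.e. related by an admissible change of variables $(x,y)\mapsto(u^2x+r,\;u^3y+u^2sx+t)$ with $u\in\mathbb{F}_q^*$ and $r,s,t\in\mathbb{F}_q$. Then there are exactly $(2q+4)/3$ isomorphism classes of elliptic curves $E$ over $\mathbb{F}_q$ whose group $E(\mathbb{F}_q)[3]$ of rational 3-torsion points is cyclic and nontrivial. Moreover, let $\chi$ be a cubic character of $\mathbb{F}_q$ (a multiplicative character of order $3$ with values in a field, for instance $\mathbb{C}$, extended by $\chi(0)=0$), let $\rho\in\mathbb{F}_q$ be a primitive cube root of unity, and let $b_0\in\mathbb{F}_q$ be a non-cube. For each set $\{a,\rho a,\rho^2a\}$, $a\in\mathbb{F}_q$, choose one of its elements, and denote by $m_a$ the chosen element of $\{a,\rho a,\rho^2 a\}$ (so $m_a=m_{\rho a}=m_{\rho^2a}$). Then the family $$\left\{\,y^2+m_a\,xy+b_0^i\,y=x^3 \;:\; i\in\{0,1,2\},\ a\in\mathbb{F}_q,\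 a^3-27b_0^i\neq 0,\ \chi(a^3-27b_0^i)\neq 1\,\right\}$$ is a complete set of representatives of these classes: every curve in the family is an elliptic curve whose rational 3-torsion subgroup is cyclic and nontrivial, and every elliptic curve over $\mathbb{F}_q$ with cyclic nontrivial rational 3-torsion subgroup is isomorphic to exactly one curve in the family. -/

import Mathlib

namespace ThreeTorsion

/-- The rational 3-torsion subgroup `E(F)[3]` of a Weierstrass curve over `F`, with respect to the
chord-and-tangent group law. -/
noncomputable def threeTorsion {F : Type*} [Field F] [DecidableEq F] (E : WeierstrassCurve F) :
    AddSubgroup E.toAffine.Point :=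
  AddSubgroup.torsionBy E.toAffine.Point 3

/-- `E` is an elliptic curve over `F` whose rational 3-torsion subgroup is cyclic and nontrivial. -/
def IsEllipticWithCyclicThreeTorsion {F : Type*} [Field F] [DecidableEq F]
    (E : WeierstrassCurve F) : Prop :=
  E.IsElliptic ∧ Nontrivial (threeTorsion E) ∧ IsAddCyclic (threeTorsion E)

/-- `F`-isomorphism of elliptic curves in Weierstrass form: an admissible change of variables
`(x, y) ↦ (u²x + r, u³y + u²sx + t)` with `u ∈ Fˣ` and `r, s, t ∈ F` carries one equation to the
other. -/
def Isomorphic {F : Type*} [Field F] (E E' : WeierstrassCurve F) : Prop :=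
  ∃ C : WeierstrassCurve.VariableChange F, C • E = E'

/-- The elliptic curves over `F` with cyclic nontrivial rational 3-torsion subgroup. -/
abbrev CyclicCurve (F : Type*) [Field F] [DecidableEq F] : Type _ :=
  {E : WeierstrassCurve F // IsEllipticWithCyclicThreeTorsion E}

/-- `F`-isomorphism, as an equivalence relation on `CyclicCurve F`. -/
def isoSetoid (F : Type*) [Field F] [DecidableEq F] : Setoid (CyclicCurve F) where
  r E E' := Isomorphic E.1 E'.1
  iseqv :=
    { refl := fun E => ⟨1, one_smul _ E.1⟩
      symm := fun {E E'} ⟨C, hC⟩ => ⟨C⁻¹, by rw [← hC, inv_smul_smul]⟩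
      trans := fun {E E' E''} ⟨C, hC⟩ ⟨C', hC'⟩ => ⟨C' * C, by rw [mul_smul, hC, hC']⟩ }

/-- The curve `y² + a x y + b y = x³`. -/
def curve {F : Type*} [Field F] (a b : F) : WeierstrassCurve F :=
  ⟨a, 0, b, 0, 0⟩

/-- The family `y² + m(a) x y + b₀ⁱ y = x³`, with `i = 0, 1, 2` and `a ∈ F` such that
`a³ - 27 b₀ⁱ ≠ 0` (nonsingularity) and `χ (a³ - 27 b₀ⁱ) ≠ 1`. -/
def family {F K : Type*} [Field F] [Field K] (χ : MulChar F K) (b₀ : F) (m : F → F) :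
    Set (WeierstrassCurve F) :=
  {E | ∃ i : Fin 3, ∃ a : F, a ^ 3 - 27 * b₀ ^ (i : ℕ) ≠ 0 ∧
    χ (a ^ 3 - 27 * b₀ ^ (i : ℕ)) ≠ 1 ∧ E = curve (m a) (b₀ ^ (i : ℕ))}

end ThreeTorsion

/-! A nonzero point satisfies 3P = 0 exactly when it is a flex. Moving it to the origin with tangent
y = 0 gives y² + axy + by = x³ (`three_nsmul_some_eq_zero_iff`). The rational 3-torsion is cyclic
and nontrivial iff the rational flexes exist and share one x-coordinate
(`isEllipticWithCyclicThreeTorsion_iff`). When F contains a primitive cube root of unity and 3 ≠ 0,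
this means for `curve a b` that b ≠ 0 and a³ - 27b is not a cube.

Since ±P are then the only flexes, isomorphisms between such curves reduce to (a, b) ↦ (ua, u³b)
(`isomorphic_curve_iff`). Scaling to a = 1 leaves one class per non-cube 1 - 27b, so 2(q - 1)/3 of
them; a = 0 leaves b modulo cubes, which gives the 2 non-cube classes. For the family, b is scaled
to some b₀ⁱ instead. The remaining u satisfy u³ = 1, so a matters only up to powers of ρ. -/

namespace ThreeTorsion

open WeierstrassCurve

/-! ### Rational 3-torsion points as flexes. -/

section Flex

variable {F : Type*} [Field F]

/-- The Weierstrass equation has the shape `y² + a₁ x y + a₃ y = x³`, so that the origin is a flex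
with tangent line `y = 0`. -/
def IsFlexForm (W : WeierstrassCurve F) : Prop :=
  W.a₂ = 0 ∧ W.a₄ = 0 ∧ W.a₆ = 0

lemma isFlexForm_curve (a b : F) : IsFlexForm (curve a b) := ⟨rfl, rfl, rfl⟩

lemma IsFlexForm.eq_curve {W : WeierstrassCurve F} (h : IsFlexForm W) : W = curve W.a₁ W.a₃ := by
  ext <;> simp [curve, h.1, h.2.1, h.2.2]

/-- A change of variables puts `E` in flex form exactly when the conditions below on its
translation part hold. -/
lemma isFlexForm_smul_iff (E : WeierstrassCurve F) (C : VariableChange F) :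
    IsFlexForm (C • E) ↔ E.a₂ - C.s * E.a₁ + 3 * C.r - C.s ^ 2 = 0 ∧
      E.a₄ - C.s * E.a₃ + 2 * C.r * E.a₂ - (C.t + C.r * C.s) * E.a₁ + 3 * C.r ^ 2
        - 2 * C.s * C.t = 0 ∧
      E.a₆ + C.r * E.a₄ + C.r ^ 2 * E.a₂ + C.r ^ 3 - C.t * E.a₃ - C.t ^ 2
        - C.r * C.t * E.a₁ = 0 := by
  simp [IsFlexForm, variableChange_def]

variable [DecidableEq F]

/-- Write 3P = 0 as 2P = -P: the tangent at P meets the curve only there. With `C.s` the tangent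
slope, a₆ = 0 says that P lies on the curve, a₄ = 0 that the line is tangent, and a₂ = 0 that the
third intersection has the same x. -/
lemma three_nsmul_some_eq_zero_iff (E : WeierstrassCurve F) {x y : F}
    (h : E.toAffine.Nonsingular x y) :
    3 • (Affine.Point.some x y h) = 0 ↔
      ∃ C : VariableChange F, C.r = x ∧ C.t = y ∧ IsFlexForm (C • E) := by
  rw [succ_nsmul, two_nsmul, add_eq_zero_iff_eq_neg]
  have heq := (Affine.equation_iff' x y).1 h.1
  constructor
  · intro h3
    have hy : y ≠ E.toAffine.negY x y := by
      intro hy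
      rw [Affine.Point.add_self_of_Y_eq hy, eq_comm, neg_eq_zero] at h3
      exact Affine.Point.some_ne_zero h h3
    rw [Affine.Point.add_self_of_Y_ne' hy, neg_inj, Affine.Point.some.injEq] at h3
    have hx := h3.1
    have hl := Affine.slope_of_Y_ne (W := E.toAffine) rfl hy
    rw [eq_div_iff (sub_ne_zero.2 hy)] at hl
    set l := E.toAffine.slope x x y y
    simp only [Affine.addX, Affine.negY] at hx hl
    refine ⟨⟨1, x, l, y⟩, rfl, rfl, (isFlexForm_smul_iff _ _).2 ⟨?_, ?_, ?_⟩⟩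
    · linear_combination -hx
    · linear_combination -hl
    · linear_combination -heq
  · rintro ⟨C, rfl, rfl, hC⟩
    obtain ⟨h2, h4, -⟩ := (isFlexForm_smul_iff _ _).1 hC
    -- At a 2-torsion point the a₄ condition would make both partial derivatives vanish.
    have hy : C.t ≠ E.toAffine.negY C.r C.t := by
      intro hy
      rcases ((Affine.nonsingular_iff _ _).1 h).2 with h' | h'
      · apply h'
        simp only [Affine.negY] at hy
        linear_combination -h4 - C.s * hy
      · exact h' hy
    have hl : E.toAffine.slope C.r C.r C.t C.t = C.s := by
      rw [Affine.slope_of_Y_ne rfl hy, div_eq_iff (sub_ne_zero.2 hy), Affine.negY]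
      linear_combination h4
    have hx : E.toAffine.addX C.r C.r C.s = C.r := by
      rw [Affine.addX]
      linear_combination -h2
    rw [Affine.Point.add_self_of_Y_ne' hy, neg_inj, Affine.Point.some.injEq, hl, Affine.negAddY, hx]
    exact ⟨rfl, by ring⟩

/-- A cyclic group killed by 3 is {0, g, -g}, and two affine points share an x-coordinate iff they
agree up to sign. -/
lemma isEllipticWithCyclicThreeTorsion_iff (E : WeierstrassCurve F) :
    IsEllipticWithCyclicThreeTorsion E ↔ E.IsElliptic ∧
      (∃ C : VariableChange F, IsFlexForm (C • E)) ∧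
      ∀ C C' : VariableChange F, IsFlexForm (C • E) → IsFlexForm (C' • E) → C.r = C'.r := by
  refine and_congr_right fun hE => ?_
  have hmem (P : E.toAffine.Point) : P ∈ threeTorsion E ↔ 3 • P = 0 := by
    rw [← natCast_zsmul]
    exact Submodule.mem_torsionBy_iff (3 : ℤ) P
  have hns (C : VariableChange F) (hC : IsFlexForm (C • E)) : E.toAffine.Nonsingular C.r C.t := by
    rw [← Affine.equation_iff_nonsingular, Affine.equation_iff']
    linear_combination -((isFlexForm_smul_iff _ _).1 hC).2.2
  have hT (C : VariableChange F) (hC : IsFlexForm (C • E)) :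
      Affine.Point.some C.r C.t (hns C hC) ∈ threeTorsion E := by
    rw [hmem, three_nsmul_some_eq_zero_iff]
    exact ⟨C, rfl, rfl, hC⟩
  constructor
  · rintro ⟨hn, hc⟩
    constructor
    · obtain ⟨⟨P, hP⟩, hP0⟩ := exists_ne (0 : threeTorsion E)
      rw [hmem] at hP
      cases P with
      | zero => exact absurd rfl hP0
      | some x y h =>
        obtain ⟨C, -, -, hC⟩ := (three_nsmul_some_eq_zero_iff E h).1 hP
        exact ⟨C, hC⟩
    · intro C C' hC hC'
      obtain ⟨g, hg⟩ := hc.exists_generator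
      have h3 : (3 : ℤ) • g = 0 := by
        ext
        have := (hmem g).1 g.2
        exact_mod_cast this
      have key (P : threeTorsion E) : P = 0 ∨ P = g ∨ P = -g := by
        obtain ⟨n, rfl⟩ := AddSubgroup.mem_zmultiples_iff.1 (hg P)
        rw [← Int.emod_add_mul_ediv n 3, add_smul, mul_comm 3, mul_smul, h3, smul_zero, add_zero]
        have h1 := Int.emod_nonneg n (by norm_num : (3 : ℤ) ≠ 0)
        have h2 := Int.emod_lt_of_pos n (by norm_num : (0 : ℤ) < 3)
        generalize n % 3 = k at *
        interval_cases k
        · simp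
        · simp
        · right; right
          rw [eq_neg_iff_add_eq_zero, ← h3, ← add_one_zsmul]
          rfl
      rw [Affine.Point.X_eq_iff (h₁ := hns C hC) (h₂ := hns C' hC')]
      have e1 := key ⟨_, hT C hC⟩
      have e2 := key ⟨_, hT C' hC'⟩
      obtain ⟨g, hgm⟩ := g
      simp only [Subtype.ext_iff, AddSubgroup.coe_neg, AddSubgroup.coe_zero] at e1 e2
      have n1 := Affine.Point.some_ne_zero (hns C hC)
      have n2 := Affine.Point.some_ne_zero (hns C' hC')
      rcases e1 with e1 | e1 | e1 <;> rcases e2 with e2 | e2 | e2 <;> simp_all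
  · rintro ⟨⟨C, hC⟩, hu⟩
    refine ⟨⟨⟨_, hT C hC⟩, 0, fun h => Affine.Point.some_ne_zero _ (congrArg Subtype.val h)⟩,
      ⟨⟨_, hT C hC⟩, ?_⟩⟩
    rintro ⟨P, hP⟩
    cases P with
    | zero => exact ⟨0, zero_smul _ _⟩
    | some x y h =>
      obtain ⟨C', rfl, rfl, hC'⟩ := (three_nsmul_some_eq_zero_iff E h).1 ((hmem _).1 hP)
      rcases (Affine.Point.X_eq_iff (h₁ := h) (h₂ := hns C hC)).1 (hu C' C hC' hC) with e | e
      · exact ⟨1, by ext; simp [e]⟩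
      · exact ⟨-1, by ext; simp [e]⟩

lemma IsEllipticWithCyclicThreeTorsion.smul {E : WeierstrassCurve F}
    (h : IsEllipticWithCyclicThreeTorsion E) (C : VariableChange F) :
    IsEllipticWithCyclicThreeTorsion (C • E) := by
  rw [isEllipticWithCyclicThreeTorsion_iff] at h ⊢
  obtain ⟨hE, ⟨D, hD⟩, hu⟩ := h
  refine ⟨inferInstance, ⟨D * C⁻¹, by rwa [mul_smul, inv_smul_smul]⟩, fun D D' hD hD' => ?_⟩
  rw [← mul_smul] at hD hD'
  have := hu _ _ hD hD'
  simpa [VariableChange.mul_def] using this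

end Flex

/-! ### The curves y² + axy + by = x³ and their isomorphisms. -/

section Curve

variable {F : Type*} [Field F]

lemma Isomorphic.symm {E E' : WeierstrassCurve F} (h : Isomorphic E E') : Isomorphic E' E := by
  obtain ⟨C, rfl⟩ := h
  exact ⟨C⁻¹, inv_smul_smul _ _⟩

lemma Isomorphic.trans {E E' E'' : WeierstrassCurve F} (h : Isomorphic E E')
    (h' : Isomorphic E' E'') : Isomorphic E E'' := by
  obtain ⟨C, rfl⟩ := h
  obtain ⟨C', rfl⟩ := h'
  exact ⟨C' * C, mul_smul _ _ _⟩

lemma curve_Δ (a b : F) : (curve a b).Δ = b ^ 3 * (a ^ 3 - 27 * b) := by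
  simp only [curve, Δ, b₂, b₄, b₆, b₈]
  ring

lemma curve_isElliptic_iff (a b : F) :
    (curve a b).IsElliptic ↔ b ≠ 0 ∧ a ^ 3 - 27 * b ≠ 0 := by
  rw [isElliptic_iff, curve_Δ, isUnit_iff_ne_zero, mul_ne_zero_iff, pow_ne_zero_iff (by norm_num)]

lemma IsFlexForm.b₈_eq_zero {W : WeierstrassCurve F} (h : IsFlexForm W) : W.b₈ = 0 := by
  simp [b₈, h.1, h.2.1, h.2.2]

/-- The 3-division polynomial of `curve a b` at the `x`-coordinate of a flex. -/
lemma divisionPolynomial_eq_zero_of_isFlexForm {a b : F} {C : VariableChange F}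
    (h : IsFlexForm (C • curve a b)) :
    C.r * (3 * C.r ^ 3 + a ^ 2 * C.r ^ 2 + 3 * a * b * C.r + 3 * b ^ 2) = 0 := by
  have := h.b₈_eq_zero
  -- Up to a power of u, b₈ of the translated curve is the 3-division polynomial evaluated at r.
  rw [variableChange_b₈] at this
  have := (mul_eq_zero.1 this).resolve_left (pow_ne_zero _ C.u⁻¹.ne_zero)
  simp only [curve, b₂, b₄, b₆, b₈] at this
  linear_combination this

/-- A cube root of `a³ - 27 b` yields a flex of `curve a b` other than the origin. -/
lemma exists_isFlexForm_of_cube (h3 : (3 : F) ≠ 0) {ρ : F} (hρ : ρ ^ 2 + ρ + 1 = 0) {a b c : F}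
    (hb : b ≠ 0) (hc : c ^ 3 = a ^ 3 - 27 * b) :
    ∃ C : VariableChange F, C.r ≠ 0 ∧ IsFlexForm (C • curve a b) := by
  obtain ⟨x, rfl⟩ : ∃ x : F, a = 3 * x := ⟨a / 3, by field_simp⟩
  obtain ⟨y, rfl⟩ : ∃ y : F, c = 3 * y := ⟨c / 3, by field_simp⟩
  have hb' : b = x ^ 3 - y ^ 3 := by
    apply mul_left_cancel₀ (pow_ne_zero 3 h3)
    linear_combination hc
  subst hb'
  -- As b = x³ - y³, the cubic factor of the 3-division polynomial has the root r = -(x² + xy + y²).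
  -- The slope solves s² + 3xs - 3r = 0, of discriminant -3(x + 2y)²; here ρ supplies √-3.
  refine ⟨⟨1, -(y ^ 2 + y * x + x ^ 2), -(2 * x + y + ρ * (x + 2 * y)),
    (y ^ 2 + y * x + x ^ 2) * ((ρ + 1) * y + x)⟩, fun h => hb ?_, ?_⟩
  · dsimp only at h
    linear_combination -(x - y) * h
  · rw [isFlexForm_smul_iff]
    simp only [curve]
    refine ⟨?_, ?_, ?_⟩
    · linear_combination -(x + 2 * y) ^ 2 * hρ
    · linear_combination 2 * (x + 2 * y) * (y ^ 2 + y * x + x ^ 2) * y * hρ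
    · linear_combination -(y ^ 2 + y * x + x ^ 2) ^ 2 * y ^ 2 * hρ

lemma isomorphic_curve_of_unit (u : Fˣ) (a b : F) :
    Isomorphic (curve a b) (curve (u * a) (u ^ 3 * b)) := by
  refine ⟨⟨u⁻¹, 0, 0, 0⟩, ?_⟩
  simp [variableChange_def, curve]

variable [DecidableEq F]

lemma isEllipticWithCyclicThreeTorsion_curve_iff (h3 : (3 : F) ≠ 0) {ρ : F}
    (hρ : ρ ^ 2 + ρ + 1 = 0) (a b : F) :
    IsEllipticWithCyclicThreeTorsion (curve a b) ↔ b ≠ 0 ∧ ∀ c : F, c ^ 3 ≠ a ^ 3 - 27 * b := by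
  rw [isEllipticWithCyclicThreeTorsion_iff, curve_isElliptic_iff]
  have h1 : IsFlexForm ((1 : VariableChange F) • curve a b) := by
    rw [one_smul]
    exact isFlexForm_curve a b
  constructor
  · rintro ⟨⟨hb, -⟩, -, hu⟩
    refine ⟨hb, fun c hc => ?_⟩
    obtain ⟨C, hr, hC⟩ := exists_isFlexForm_of_cube h3 hρ hb hc
    exact hr (hu C 1 hC h1)
  · rintro ⟨hb, hc⟩
    have h0 (C : VariableChange F) (hC : IsFlexForm (C • curve a b)) : C.r = 0 := by
      by_contra hr
      have := (mul_eq_zero.1 (divisionPolynomial_eq_zero_of_isFlexForm hC)).resolve_left hr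
      -- Multiplied by 9b/r³, the cubic in r becomes (3b/r + a)³ = a³ - 27b.
      apply hc (3 * b / C.r + a)
      field_simp
      linear_combination 9 * b * this
    refine ⟨⟨hb, fun h => hc 0 (by rw [h]; norm_num)⟩, ⟨1, h1⟩, fun C C' hC hC' => ?_⟩
    rw [h0 C hC, h0 C' hC']

lemma IsEllipticWithCyclicThreeTorsion.exists_isomorphic_curve {E : WeierstrassCurve F}
    (h : IsEllipticWithCyclicThreeTorsion E) :
    ∃ a b : F, Isomorphic E (curve a b) ∧ IsEllipticWithCyclicThreeTorsion (curve a b) := by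
  obtain ⟨C, hC⟩ := ((isEllipticWithCyclicThreeTorsion_iff E).1 h).2.1
  have := h.smul C
  rw [hC.eq_curve] at this
  exact ⟨_, _, ⟨C, hC.eq_curve⟩, this⟩

/-- The origin of the target comes from a flex with x = 0, so t = 0 or t = -b. The second case
differs from the first by negation, which turns u into -u. -/
lemma IsEllipticWithCyclicThreeTorsion.isomorphic_curve_iff {a b a' b' : F}
    (h : IsEllipticWithCyclicThreeTorsion (curve a b)) :
    Isomorphic (curve a b) (curve a' b') ↔ ∃ u : Fˣ, a' = u * a ∧ b' = u ^ 3 * b := by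
  constructor
  · rintro ⟨C, hC⟩
    rw [isEllipticWithCyclicThreeTorsion_iff, curve_isElliptic_iff] at h
    obtain ⟨⟨hb, -⟩, -, hu⟩ := h
    have hf : IsFlexForm (C • curve a b) := hC ▸ isFlexForm_curve a' b'
    have hr : C.r = 0 := hu C 1 hf (by rw [one_smul]; exact isFlexForm_curve a b)
    obtain ⟨-, h4, h6⟩ := (isFlexForm_smul_iff _ _).1 hf
    have ha' : (C • curve a b).a₁ = a' := by rw [hC]; rfl
    have hb' : (C • curve a b).a₃ = b' := by rw [hC]; rfl
    rw [variableChange_a₁] at ha'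
    rw [variableChange_a₃] at hb'
    simp only [curve, hr] at h4 h6 ha' hb'
    have ht : C.t * (C.t + b) = 0 := by linear_combination -h6
    rcases mul_eq_zero.1 ht with ht | ht
    · have hs : C.s = 0 := by
        rw [ht] at h4
        exact (mul_eq_zero.1 (show C.s * b = 0 by linear_combination -h4)).resolve_right hb
      refine ⟨C.u⁻¹, ?_, ?_⟩
      · rw [← ha', hs]; ring
      · rw [← hb', ht]; ring
    · have ht : C.t = -b := by linear_combination ht
      have hs : C.s = -a := by
        rw [ht] at h4
        exact eq_neg_of_add_eq_zero_left <|
          (mul_eq_zero.1 (show (C.s + a) * b = 0 by linear_combination h4)).resolve_right hb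
      refine ⟨-C.u⁻¹, ?_, ?_⟩
      · rw [← ha', hs, Units.val_neg]; ring
      · rw [← hb', ht, Units.val_neg]; ring
  · rintro ⟨u, rfl, rfl⟩
    exact isomorphic_curve_of_unit u a b

end Curve

/-! ### Cubes in F, cubic characters, and counting non-cubes. -/

section Cubes

variable {F : Type*} [Field F]

lemma three_ne_zero_of_card [Fintype F] (hq : Fintype.card F % 3 = 1) : (3 : F) ≠ 0 := by
  intro h
  have h0 : (Fintype.card F : F) = 0 := FiniteField.cast_card_eq_zero F
  rw [← Nat.mod_add_div (Fintype.card F) 3, hq] at h0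
  push_cast at h0
  rw [h] at h0
  simp at h0

lemma twentySeven_ne_zero_of_card [Fintype F] (hq : Fintype.card F % 3 = 1) : (27 : F) ≠ 0 := by
  rw [show (27 : F) = 3 ^ 3 by norm_num]
  exact pow_ne_zero _ (three_ne_zero_of_card hq)

lemma sq_add_self_add_one_of_isPrimitiveRoot {ρ : F} (hρ : IsPrimitiveRoot ρ 3) :
    ρ ^ 2 + ρ + 1 = 0 := by
  have h1 : ρ - 1 ≠ 0 := sub_ne_zero.2 (hρ.ne_one (by norm_num))
  apply (mul_eq_zero.1 (show (ρ - 1) * (ρ ^ 2 + ρ + 1) = 0 from ?_)).resolve_left h1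
  linear_combination hρ.pow_eq_one

lemma three_dvd_card_units [Fintype F] (hq : Fintype.card F % 3 = 1) : 3 ∣ Nat.card Fˣ := by
  rw [Nat.card_units, Nat.card_eq_fintype_card]
  omega

lemma exists_isPrimitiveRoot_three [Fintype F] (hq : Fintype.card F % 3 = 1) :
    ∃ ρ : F, IsPrimitiveRoot ρ 3 := by
  have : Fact (Nat.Prime 3) := ⟨Nat.prime_three⟩
  obtain ⟨u, hu⟩ := exists_prime_orderOf_dvd_card' 3 (three_dvd_card_units hq)
  exact ⟨u, (IsPrimitiveRoot.coe_units_iff).2 (hu ▸ IsPrimitiveRoot.orderOf u)⟩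

lemma index_cubes [Fintype F] (hq : Fintype.card F % 3 = 1) :
    (powMonoidHom 3 : Fˣ →* Fˣ).range.index = 3 := by
  rw [IsCyclic.index_powMonoidHom_range]
  exact Nat.gcd_eq_right (three_dvd_card_units hq)

lemma mem_cubes_iff (u : Fˣ) :
    u ∈ (powMonoidHom 3 : Fˣ →* Fˣ).range ↔ ∃ x : F, x ^ 3 = u := by
  constructor
  · rintro ⟨v, rfl⟩
    exact ⟨v, by simp⟩
  · rintro ⟨x, hx⟩
    have hx0 : x ≠ 0 := by
      rintro rfl
      exact u.ne_zero (by rw [← hx]; norm_num)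
    exact ⟨Units.mk0 x hx0, by ext; simpa using hx⟩

lemma ne_zero_of_noncube {b : F} (hb : ∀ x : F, x ^ 3 ≠ b) : b ≠ 0 := by
  rintro rfl
  exact hb 0 (by norm_num)

lemma noncube_mul_iff {u b : F} (hu : u ≠ 0) :
    (∀ x : F, x ^ 3 ≠ u ^ 3 * b) ↔ ∀ x : F, x ^ 3 ≠ b := by
  constructor
  · rintro h x rfl
    exact h (u * x) (by ring)
  · intro h x hx
    exact h (x / u) (by rw [div_pow, hx]; field_simp)

/-- The units modulo cubes form a group of prime order 3, generated by any non-cube. -/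
lemma exists_eq_cube_mul_pow [Fintype F] (hq : Fintype.card F % 3 = 1) {b₀ : F}
    (hb₀ : ∀ x : F, x ^ 3 ≠ b₀) {b : F} (hb : b ≠ 0) :
    ∃ (u : Fˣ) (i : Fin 3), b = u ^ 3 * b₀ ^ (i : ℕ) := by
  have : Fact (Nat.Prime 3) := ⟨Nat.prime_three⟩
  set H := (powMonoidHom 3 : Fˣ →* Fˣ).range
  set β := Units.mk0 b₀ (ne_zero_of_noncube hb₀)
  have hβ : (QuotientGroup.mk β : Fˣ ⧸ H) ≠ 1 := by
    rw [Ne, QuotientGroup.eq_one_iff, mem_cubes_iff]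
    rintro ⟨x, hx⟩
    exact hb₀ x hx
  have hcard : Nat.card (Fˣ ⧸ H) = 3 := index_cubes hq
  obtain ⟨n, hn⟩ := mem_powers_of_prime_card (g' := QuotientGroup.mk (Units.mk0 b hb)) hcard hβ
  dsimp only at hn
  have h3 : (QuotientGroup.mk β : Fˣ ⧸ H) ^ 3 = 1 := hcard ▸ pow_card_eq_one'
  rw [pow_eq_pow_mod n h3, ← QuotientGroup.mk_pow, QuotientGroup.eq] at hn
  obtain ⟨v, hv⟩ := hn
  refine ⟨v, ⟨n % 3, Nat.mod_lt _ (by norm_num)⟩, ?_⟩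
  rw [eq_inv_mul_iff_mul_eq] at hv
  have := congrArg Units.val hv
  simp only [powMonoidHom_apply, Units.val_mul, Units.val_pow_eq_pow_val, Units.val_mk0, β] at this
  rw [← this, mul_comm]

lemma eq_of_cube_mul_pow_eq {b₀ : F} (hb₀ : ∀ x : F, x ^ 3 ≠ b₀) {u : Fˣ} {i j : Fin 3}
    (h : b₀ ^ (j : ℕ) = u ^ 3 * b₀ ^ (i : ℕ)) : i = j := by
  have hb := ne_zero_of_noncube hb₀
  have hu := u.ne_zero
  have e (x : F) (hx : x ^ 3 = b₀) : i = j := absurd hx (hb₀ x)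
  fin_cases i <;> fin_cases j <;> simp at h e ⊢
  · exact e _ h.symm
  · exact e (b₀ / u) (by rw [div_pow, ← h]; field_simp)
  · exact e (1 / u) (by rw [div_pow, div_eq_iff (pow_ne_zero _ hu)]; linear_combination h)
  · refine e u (mul_right_cancel₀ hb ?_)
    linear_combination -h
  · exact e (u * b₀) (by linear_combination -b₀ * h)
  · refine e (1 / u) ?_
    rw [div_pow, div_eq_iff (pow_ne_zero _ hu)]
    refine mul_right_cancel₀ hb ?_
    linear_combination h

lemma pow_noncube {b₀ : F} (hb₀ : ∀ x : F, x ^ 3 ≠ b₀) {i : Fin 3} (hi : i ≠ 0) (x : F) :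
    x ^ 3 ≠ b₀ ^ (i : ℕ) := by
  intro hx
  have hx0 : x ≠ 0 := by
    rintro rfl
    exact pow_ne_zero (i : ℕ) (ne_zero_of_noncube hb₀) (by rw [← hx]; norm_num)
  exact hi (eq_of_cube_mul_pow_eq hb₀ (u := Units.mk0 x hx0) (i := 0) (j := i) (by simp [hx])).symm

/-- χ is trivial on nonzero cubes. Were it also 1 at a non-cube, it would be trivial, since that
element and the cubes generate the units. -/
lemma mulChar_ne_one_iff [Fintype F] (hq : Fintype.card F % 3 = 1) {K : Type*} [Field K]
    {χ : MulChar F K} (hχ : orderOf χ = 3) {x : F} (hx : x ≠ 0) :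
    χ x ≠ 1 ↔ ∀ c : F, c ^ 3 ≠ x := by
  have h3 (u : F) (hu : u ≠ 0) : χ (u ^ 3) = 1 := by
    rw [map_pow, ← MulChar.pow_apply' χ (by norm_num), ← hχ, pow_orderOf_eq_one]
    exact MulChar.one_apply (isUnit_iff_ne_zero.2 hu)
  constructor
  · rintro h c rfl
    exact h (h3 c (by rintro rfl; norm_num at hx))
  · intro h hx1
    have : χ = 1 := by
      ext y
      obtain ⟨u, i, hy⟩ := exists_eq_cube_mul_pow hq h y.ne_zero
      rw [hy, map_mul, h3 _ u.ne_zero, map_pow, hx1, one_pow, one_mul,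
        MulChar.one_apply (hy ▸ y.isUnit)]
    rw [this, orderOf_one] at hχ
    norm_num at hχ

lemma mem_family_iff [Fintype F] (hq : Fintype.card F % 3 = 1) {K : Type*} [Field K] {χ : MulChar F K}
    (hχ : orderOf χ = 3) {b₀ : F} (m : F → F) (E : WeierstrassCurve F) :
    E ∈ family χ b₀ m ↔ ∃ (i : Fin 3) (a : F), (∀ c : F, c ^ 3 ≠ a ^ 3 - 27 * b₀ ^ (i : ℕ)) ∧
      E = curve (m a) (b₀ ^ (i : ℕ)) := by
  refine exists_congr fun i => exists_congr fun a => ?_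
  rw [← and_assoc]
  refine and_congr_left fun _ => ⟨fun ⟨h0, h1⟩ => (mulChar_ne_one_iff hq hχ h0).1 h1, fun h => ?_⟩
  exact ⟨ne_zero_of_noncube h, (mulChar_ne_one_iff hq hχ (ne_zero_of_noncube h)).2 h⟩

lemma mem_orbit_iff {ρ : F} (hρ : ρ ^ 2 + ρ + 1 = 0) (a z : F) :
    z ∈ ({a, ρ * a, ρ ^ 2 * a} : Set F) ↔ z ^ 3 = a ^ 3 := by
  have h : z ^ 3 - a ^ 3 = (z - a) * ((z - ρ * a) * (z - ρ ^ 2 * a)) := by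
    linear_combination (a * z ^ 2 - ρ * a ^ 2 * z + a ^ 3 * (ρ - 1)) * hρ
  rw [← sub_eq_zero (a := z ^ 3), h, mul_eq_zero, mul_eq_zero]
  simp [sub_eq_zero]

lemma card_noncubes [Fintype F] (hq : Fintype.card F % 3 = 1) :
    3 * Nat.card {c : F // ∀ x : F, x ^ 3 ≠ c} = 2 * (Fintype.card F - 1) := by
  set H := (powMonoidHom 3 : Fˣ →* Fˣ).range
  have e : {c : F | ∀ x : F, x ^ 3 ≠ c} = Units.val '' (H : Set Fˣ)ᶜ := by
    ext c
    constructor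
    · intro hc
      refine ⟨Units.mk0 c (ne_zero_of_noncube hc), fun h => ?_, rfl⟩
      obtain ⟨x, hx⟩ := (mem_cubes_iff _).1 h
      exact hc x hx
    · rintro ⟨u, hu, rfl⟩ x hx
      exact hu ((mem_cubes_iff _).2 ⟨x, hx⟩)
  have h1 : Nat.card {c : F // ∀ x : F, x ^ 3 ≠ c} = (H : Set Fˣ)ᶜ.ncard := by
    rw [← Set.ncard_image_of_injective _ Units.val_injective, ← e]
    rfl
  have h2 := Set.ncard_add_ncard_compl (H : Set Fˣ)
  have h3 := H.card_mul_index
  rw [index_cubes hq] at h3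
  have h4 : (H : Set Fˣ).ncard = Nat.card H := rfl
  have h5 : Nat.card Fˣ = Fintype.card F - 1 := by
    rw [Nat.card_units, Nat.card_eq_fintype_card]
  omega

end Cubes

/-! ### Counting the isomorphism classes. -/

section Classification

variable {F : Type*} [Field F] [Fintype F] [DecidableEq F]

lemma isEllipticWithCyclicThreeTorsion_curve_iff_of_card (hq : Fintype.card F % 3 = 1) (a b : F) :
    IsEllipticWithCyclicThreeTorsion (curve a b) ↔ b ≠ 0 ∧ ∀ c : F, c ^ 3 ≠ a ^ 3 - 27 * b := by
  obtain ⟨ρ, hρ⟩ := exists_isPrimitiveRoot_three (F := F) hq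
  exact isEllipticWithCyclicThreeTorsion_curve_iff (three_ne_zero_of_card hq)
    (sq_add_self_add_one_of_isPrimitiveRoot hρ) a b

lemma isEllipticWithCyclicThreeTorsion_curve_one (hq : Fintype.card F % 3 = 1) {c : F}
    (hc : ∀ x : F, x ^ 3 ≠ c) : IsEllipticWithCyclicThreeTorsion (curve 1 ((1 - c) / 27)) := by
  have h27 := twentySeven_ne_zero_of_card (F := F) hq
  rw [isEllipticWithCyclicThreeTorsion_curve_iff_of_card hq, mul_div_cancel₀ _ h27]
  refine ⟨div_ne_zero (fun h => hc 1 ?_) h27, fun x hx => hc x ?_⟩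
  · linear_combination h
  · linear_combination hx

lemma isEllipticWithCyclicThreeTorsion_curve_zero_iff (hq : Fintype.card F % 3 = 1) (b : F) :
    IsEllipticWithCyclicThreeTorsion (curve 0 b) ↔ ∀ x : F, x ^ 3 ≠ b := by
  rw [isEllipticWithCyclicThreeTorsion_curve_iff_of_card hq,
    show (0 : F) ^ 3 - 27 * b = (-3) ^ 3 * b by ring,
    noncube_mul_iff (neg_ne_zero.2 (three_ne_zero_of_card hq))]
  exact and_iff_right_of_imp ne_zero_of_noncube

/-- Representatives of the isomorphism classes: those with `a = 1`, indexed by the non-cube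
`1 - 27 b`, and those with `a = 0`, for which `b` is one of `b₀`, `b₀²`. -/
def representative (hq : Fintype.card F % 3 = 1) {b₀ : F} (hb₀ : ∀ x : F, x ^ 3 ≠ b₀) :
    {c : F // ∀ x : F, x ^ 3 ≠ c} ⊕ {i : Fin 3 // i ≠ 0} → CyclicCurve F
  | .inl c => ⟨curve 1 ((1 - c) / 27), isEllipticWithCyclicThreeTorsion_curve_one hq c.2⟩
  | .inr i => ⟨curve 0 (b₀ ^ (i.1 : ℕ)),
      (isEllipticWithCyclicThreeTorsion_curve_zero_iff hq _).2 (pow_noncube hb₀ i.2)⟩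

lemma bijective_mk_representative (hq : Fintype.card F % 3 = 1) {b₀ : F}
    (hb₀ : ∀ x : F, x ^ 3 ≠ b₀) :
    Function.Bijective fun x => (Quotient.mk (isoSetoid F) (representative hq hb₀ x)) := by
  have h27 := twentySeven_ne_zero_of_card (F := F) hq
  constructor
  · intro x y hxy
    have h : Isomorphic (representative hq hb₀ x).1 (representative hq hb₀ y).1 :=
      Quotient.exact hxy
    have hx := (representative hq hb₀ x).2
    rcases x with ⟨c, hc⟩ | ⟨i, hi⟩ <;> rcases y with ⟨d, hd⟩ | ⟨j, hj⟩ <;>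
      simp only [representative] at h hx <;> rw [hx.isomorphic_curve_iff] at h <;>
      obtain ⟨u, hu, hu'⟩ := h
    · rw [mul_one] at hu
      rw [← hu, div_eq_iff h27] at hu'
      congr 2
      field_simp at hu'
      linear_combination hu'
    · rw [mul_one] at hu
      exact absurd hu.symm u.ne_zero
    · rw [mul_zero] at hu
      exact absurd hu one_ne_zero
    · congr 2
      exact eq_of_cube_mul_pow_eq hb₀ hu'
  · intro Q
    obtain ⟨⟨E, hE⟩, rfl⟩ := Quotient.exists_rep Q
    obtain ⟨a, b, hi, hc⟩ := hE.exists_isomorphic_curve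
    suffices ∃ x, Isomorphic (curve a b) (representative hq hb₀ x).1 by
      obtain ⟨x, hx⟩ := this
      exact ⟨x, Quotient.sound (hi.trans hx).symm⟩
    rcases eq_or_ne a 0 with rfl | ha
    · rw [isEllipticWithCyclicThreeTorsion_curve_zero_iff hq] at hc
      obtain ⟨u, i, rfl⟩ := exists_eq_cube_mul_pow hq hb₀ (ne_zero_of_noncube hc)
      refine ⟨.inr ⟨i, ?_⟩, ?_⟩
      · rintro rfl
        exact hc u (by simp)
      · refine Isomorphic.symm ?_
        simpa [representative] using isomorphic_curve_of_unit u 0 (b₀ ^ (i : ℕ))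
    · rw [isEllipticWithCyclicThreeTorsion_curve_iff_of_card hq] at hc
      -- Scaling by a⁻¹ makes a = 1 and changes a³ - 27b only by a cube.
      have e : a ^ 3 - 27 * b = a ^ 3 * (1 - 27 * (b / a ^ 3)) := by field_simp
      rw [e, noncube_mul_iff ha] at hc
      refine ⟨.inl ⟨_, hc.2⟩, Isomorphic.symm ?_⟩
      have := isomorphic_curve_of_unit (Units.mk0 a ha) 1 (b / a ^ 3)
      simp only [representative, sub_sub_cancel, mul_div_cancel_left₀ _ h27]
      simpa [mul_div_cancel₀ _ (pow_ne_zero 3 ha)] using this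

lemma exists_noncube (hq : Fintype.card F % 3 = 1) : ∃ b₀ : F, ∀ x : F, x ^ 3 ≠ b₀ := by
  by_contra! h
  have hc := card_noncubes (F := F) hq
  have : IsEmpty {c : F // ∀ x : F, x ^ 3 ≠ c} := ⟨fun c => (h c.1).elim c.2⟩
  have := Fintype.one_lt_card (α := F)
  rw [Nat.card_of_isEmpty] at hc
  omega

lemma card_isomorphism_classes (hq : Fintype.card F % 3 = 1) :
    (Nat.card (Quotient (isoSetoid F)) : ℚ) = (2 * (Fintype.card F : ℚ) + 4) / 3 := by
  obtain ⟨b₀, hb₀⟩ := exists_noncube (F := F) hq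
  rw [← Nat.card_eq_of_bijective _ (bijective_mk_representative hq hb₀), Nat.card_sum]
  have h2 : Nat.card {i : Fin 3 // i ≠ 0} = 2 := by simp
  have h := card_noncubes (F := F) hq
  have h' : 3 * Nat.card {c : F // ∀ x : F, x ^ 3 ≠ c} + 2 = 2 * Fintype.card F := by
    have := Fintype.card_pos (α := F)
    omega
  rw [h2, eq_div_iff (by norm_num)]
  push_cast
  have : (3 * Nat.card {c : F // ∀ x : F, x ^ 3 ≠ c} + 2 : ℚ) = 2 * Fintype.card F := by
    exact_mod_cast h'
  linear_combination this

end Classification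

end ThreeTorsion

theorem mainTheorem3 {F : Type*} [Field F] [Fintype F] [DecidableEq F]
    (hq : Fintype.card F % 3 = 1) :
    (Nat.card (Quotient (ThreeTorsion.isoSetoid F)) : ℚ) = (2 * (Fintype.card F : ℚ) + 4) / 3 ∧
    ∀ {K : Type*} [Field K] (χ : MulChar F K) (_ : orderOf χ = 3)
      (ρ : F) (_ : IsPrimitiveRoot ρ 3)
      (b₀ : F) (_ : ∀ x : F, x ^ 3 ≠ b₀)
      (m : F → F) (_ : ∀ a : F, m a ∈ ({a, ρ * a, ρ ^ 2 * a} : Set F))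
      (_ : ∀ a a' : F, ({a, ρ * a, ρ ^ 2 * a} : Set F) = {a', ρ * a', ρ ^ 2 * a'} → m a = m a'),
      (∀ E ∈ ThreeTorsion.family χ b₀ m, ThreeTorsion.IsEllipticWithCyclicThreeTorsion E) ∧
      (∀ E : WeierstrassCurve F, ThreeTorsion.IsEllipticWithCyclicThreeTorsion E →
        ∃! R : WeierstrassCurve F, R ∈ ThreeTorsion.family χ b₀ m ∧ ThreeTorsion.Isomorphic E R) := by
  open ThreeTorsion in
  refine ⟨card_isomorphism_classes hq, ?_⟩
  intro K _ χ hχ ρ hρ b₀ hb₀ m hm hm'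
  have hρ' := sq_add_self_add_one_of_isPrimitiveRoot hρ
  have hm3 (a : F) : m a ^ 3 = a ^ 3 := (mem_orbit_iff hρ' _ _).1 (hm a)
  have hb (i : Fin 3) : b₀ ^ (i : ℕ) ≠ 0 := pow_ne_zero _ (ne_zero_of_noncube hb₀)
  have hfam : ∀ E ∈ family χ b₀ m, IsEllipticWithCyclicThreeTorsion E := by
    intro E hE
    obtain ⟨i, a, hc, rfl⟩ := (mem_family_iff hq hχ m E).1 hE
    rw [isEllipticWithCyclicThreeTorsion_curve_iff_of_card hq, hm3]
    exact ⟨hb i, hc⟩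
  refine ⟨hfam, fun E hE => ?_⟩
  refine existsUnique_of_exists_of_unique ?_ ?_
  · obtain ⟨a, b, hi, hc⟩ := hE.exists_isomorphic_curve
    rw [isEllipticWithCyclicThreeTorsion_curve_iff_of_card hq] at hc
    obtain ⟨u, i, rfl⟩ := exists_eq_cube_mul_pow hq hb₀ hc.1
    obtain ⟨z, rfl⟩ : ∃ z, a = u * z := ⟨u⁻¹ * a, by simp⟩
    have hc' := hc.2
    rw [show (u * z) ^ 3 - 27 * (u ^ 3 * b₀ ^ (i : ℕ)) = u ^ 3 * (z ^ 3 - 27 * b₀ ^ (i : ℕ)) by ring,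
      noncube_mul_iff u.ne_zero] at hc'
    refine ⟨curve (m z) (b₀ ^ (i : ℕ)), (mem_family_iff hq hχ m _).2 ⟨i, z, hc', rfl⟩,
      hi.trans ((isomorphic_curve_of_unit u z _).symm.trans ?_)⟩
    have hρ0 : ρ ≠ 0 := hρ.ne_zero (by norm_num)
    -- Scaling by a cube root of unity moves z to its chosen representative and fixes b₀ⁱ.
    have key (v : F) (hv0 : v ≠ 0) (hv : v ^ 3 = 1) (hmz : m z = v * z) :
        Isomorphic (curve z (b₀ ^ (i : ℕ))) (curve (m z) (b₀ ^ (i : ℕ))) := by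
      have := isomorphic_curve_of_unit (Units.mk0 v hv0) z (b₀ ^ (i : ℕ))
      rwa [Units.val_mk0, hv, one_mul, ← hmz] at this
    rcases hm z with h | h | h
    · exact key 1 one_ne_zero (one_pow _) (by rw [h, one_mul])
    · exact key ρ hρ0 hρ.pow_eq_one h
    · exact key (ρ ^ 2) (pow_ne_zero _ hρ0)
        (by rw [← pow_mul, mul_comm, pow_mul, hρ.pow_eq_one, one_pow]) h
  · rintro R R' ⟨hR, hER⟩ ⟨hR', hER'⟩
    have hcR := hfam R hR
    have hiso := hER.symm.trans hER'
    obtain ⟨i, a, -, rfl⟩ := (mem_family_iff hq hχ m R).1 hR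
    obtain ⟨j, a', -, rfl⟩ := (mem_family_iff hq hχ m R').1 hR'
    obtain ⟨u, hu, hu'⟩ := hcR.isomorphic_curve_iff.1 hiso
    -- The class of b modulo cubes determines i; then u³ = 1, so a and a' lie in one ρ-orbit.
    obtain rfl := eq_of_cube_mul_pow_eq hb₀ hu'
    have hu1 : (u : F) ^ 3 = 1 := (mul_eq_right₀ (hb i)).1 hu'.symm
    have ha : a ^ 3 = a' ^ 3 := by
      rw [← hm3 a, ← hm3 a', hu, mul_pow, hu1, one_mul]
    rw [hm' a a' (Set.ext fun z => by rw [mem_orbit_iff hρ', mem_orbit_iff hρ', ha])]
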